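/- Let $(X_n,d_n,m_n)$, $n\ge 1$, be metric spaces equipped with Borel measures, and write $B_n(x,r)$ for open balls in $X_n$ and $B_\infty(x,r)$ for open balls in $X_\infty$ below. Assume the following. (A4) There are nondecreasing functions $V_n$ ($1\le n\le\infty$), $V_l$, $V_u$ from $(0,\infty)$ to $(0,\infty)$ and constants $\alpha,\alpha'>0$, $C_{\mathrm v}\ge 1$ such that $$C_{\mathrm v}^{-1}\Big(\frac Rr\Big)^{\alpha}\le \frac{V_j(R)}{V_j(r)}\le C_{\mathrm v}\Big(\frac Rr\Big)^{\alpha'}\qquad (0<r\le R<\infty,\ j\in\{1,2,\dots\}\cup\{l,u\}),$$ $$C_{\mathrm v}^{-1}V_n(r)\le m_n(B_n(x,r))\le C_{\mathrm v}V_n(r)\qquad (x\in X_n,\ 0<r<\operatorname{diam}(X_n,d_n),\ 1\le n<\infty),$$ $$C_{\mathrm v}^{-1}V_l(r)\le V_n(r)\le C_{\mathrm v}V_u(r)\qquad (r>0,\ 1\le n\le\infty).$$ (A5) $V_n\to V_\infty$ uniformly on compact subsets of $[0,\infty)$ (where all these functions are given the value $0$ at $0$). (A6) For $1\le n<\infty$,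 $(X_n,d_n)$ is a proper length space (closed balls are compact, and the distance of two points is the infimum of the lengths of the curves connecting them), $p_n\in X_n$, $(X_\infty,d_\infty)$ is a complete metric space, $p_\infty\in X_\infty$, and $(X_n,d_n,p_n)\to(X_\infty,d_\infty,p_\infty)$ in the pointed Gromov–Hausdorff sense: for all $0<\epsilon<r$ there is $i_0$ such that for each $i\ge i_0$ there is a map $f:B_i(p_i,r)\to X_\infty$ with $f(p_i)=p_\infty$, with $|d_\infty(f(x),f(y))-d_i(x,y)|<\epsilon$ for all $x,y\in B_i(p_i,r)$, and such that every point of $B_\infty(p_\infty,r-\epsilon)$ is at distance less than $\epsilon$ from $f(B_i(p_i,r))$. Then there are sequences of positive numbers $(\epsilon_n)_{n\ge1}$ and $(R_n)_{n\ge1}$ with $\epsilon_n\downarrow0$ and $R_n\uparrow\infty$ (monotonically), and maps $$f_n:\overline{B_n(p_n,R_n)}\to B_\infty(p_\infty,R_n),\qquad g_n:\overline{B_\infty(p_\infty,R_n)}\to B_n(p_n,R_n)\qquad(n\ge1),$$ where the bar denotes the closure of the open ball, such that for all $n\ge 1$: 1. $f_n$ is measurable with respect to the completion of the Borel $\sigma$-algebra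 of $X_n$ under $m_n$, and $g_n$ is measurable with respect to the completion of the Borel $\sigma$-algebra of $X_\infty$ under every Borel measure on $X_\infty$ (the targets carry their Borel $\sigma$-algebras); 2. $f_n(\overline{B_n(p_n,R_n)})$ is a finite $2\epsilon_n$-net in $B_\infty(p_\infty,R_n)$, i.e. a finite subset such that every point of $B_\infty(p_\infty,R_n)$ is within distance $2\epsilon_n$ of it; 3. $|d_\infty(f_n(x),f_n(y))-d_n(x,y)|\le\epsilon_n$ and $d_n(x,g_n(f_n(x)))\le\epsilon_n$ for all $x,y\in\overline{B_n(p_n,R_n)}$; 4. $|d_\infty(x,y)-d_n(g_n(x),g_n(y))|\le\epsilon_n$ and $d_\infty(x,f_n(g_n(x)))\le\epsilon_n$ for all $x,y\in\overline{B_\infty(p_\infty,R_n)}$; 5. $f_n(p_n)=p_\infty$ and $g_n(p_\infty)=p_n$. -/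

import Mathlib

open Set Filter Topology MeasureTheory

/-- A metric space is a *length space* if the distance between any two points is the infimum of the
lengths of the curves connecting them (the length of a curve is its total variation). -/
def IsLengthSpace (Z : Type*) [MetricSpace Z] : Prop :=
  ∀ x y : Z, edist x y = ⨅ γ : Path x y, eVariationOn γ univ

/-- Pointed Gromov-Hausdorff convergence of `(X i, p i)` to `(Y, q)`: for all `0 < ε < r` and all
large `i` there is a map from the open ball `B(p i, r)` to `Y` which sends `p i` to `q`, distorts
distances by less than `ε`, and whose image has an `ε`-neighbourhood containing `B(q, r - ε)`.
The map is written as a function on all of `X i` of which only the values on `B(p i, r)` matter. -/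
def PointedGHConverges {X : ℕ → Type*} [∀ n, MetricSpace (X n)] {Y : Type*} [MetricSpace Y]
    (p : ∀ n, X n) (q : Y) : Prop :=
  ∀ r > 0, ∀ ε > 0, ε < r → ∃ i₀ : ℕ, ∀ i ≥ i₀, ∃ f : X i → Y,
    f (p i) = q ∧
    (∀ x ∈ Metric.ball (p i) r, ∀ y ∈ Metric.ball (p i) r,
      |dist (f x) (f y) - dist x y| < ε) ∧
    Metric.ball q (r - ε) ⊆ Metric.thickening ε (f '' Metric.ball (p i) r)

/-- A function is an increasing function from `(0, ∞)` to `(0, ∞)`. -/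
def IsGauge (V : ℝ → ℝ) : Prop :=
  (∀ r > 0, 0 < V r) ∧ MonotoneOn V (Ioi 0)

/-- `C⁻¹ (R / r) ^ α ≤ V R / V r ≤ C (R / r) ^ α'` for all `0 < r ≤ R`. -/
def HasPowerGrowth (C α α' : ℝ) (V : ℝ → ℝ) : Prop :=
  ∀ r R : ℝ, 0 < r → r ≤ R →
    C⁻¹ * (R / r) ^ α ≤ V R / V r ∧ V R / V r ≤ C * (R / r) ^ α'

/-- The uniform volume growth assumption for the metric measure spaces `(X n, m n)`, with gauge
functions `V n` for the spaces, `Vinf` for the index `∞`, and lower and upper gauge functions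
`Vl`, `Vu`. -/
def UniformVolumeGrowth {X : ℕ → Type*} [∀ n, MetricSpace (X n)] [∀ n, MeasurableSpace (X n)]
    (m : ∀ n, Measure (X n)) (V : ℕ → ℝ → ℝ) (Vinf Vl Vu : ℝ → ℝ) : Prop :=
  (∀ n, IsGauge (V n)) ∧ IsGauge Vinf ∧ IsGauge Vl ∧ IsGauge Vu ∧
  ∃ α α' C : ℝ, 0 < α ∧ 0 < α' ∧ 1 ≤ C ∧
    (∀ n, HasPowerGrowth C α α' (V n)) ∧ HasPowerGrowth C α α' Vl ∧ HasPowerGrowth C α α' Vu ∧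
    (∀ (n : ℕ) (x : X n) (r : ℝ), 0 < r → ENNReal.ofReal r < Metric.ediam (univ : Set (X n)) →
      ENNReal.ofReal (C⁻¹ * V n r) ≤ m n (Metric.ball x r) ∧
      m n (Metric.ball x r) ≤ ENNReal.ofReal (C * V n r)) ∧
    (∀ (n : ℕ) (r : ℝ), 0 < r → C⁻¹ * Vl r ≤ V n r ∧ V n r ≤ C * Vu r) ∧
    (∀ r : ℝ, 0 < r → C⁻¹ * Vl r ≤ Vinf r ∧ Vinf r ≤ C * Vu r)

/-- Uniform convergence `V n → Vinf` on compact subsets of `[0, ∞)`. The functions live on `(0, ∞)`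
(at `0` all of them are understood to be extended by the value `0`), so only the positive points of
the compact set matter. -/
def GaugesConverge (V : ℕ → ℝ → ℝ) (Vinf : ℝ → ℝ) : Prop :=
  ∀ K : Set ℝ, IsCompact K → K ⊆ Ici 0 → TendstoUniformlyOn V Vinf atTop (K ∩ Ioi 0)

/-- The restriction of `f` to `A` is measurable from the completion of the Borel `σ`-algebra with
respect to `μ` to the Borel `σ`-algebra (for measurable `A`): preimages in `A` of Borel sets differ
from a Borel set by a subset of a `μ`-null Borel set. -/
def CompletionMeasurableOn {Z W : Type*} [MeasurableSpace Z] [MeasurableSpace W]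
    (μ : Measure Z) (f : Z → W) (A : Set Z) : Prop :=
  ∀ S : Set W, MeasurableSet S → NullMeasurableSet (A ∩ f ⁻¹' S) μ

/-- `N` is a finite `δ`-net in `A`: a finite subset of `A` such that every point of `A` is within
distance `δ` of some point of `N`. -/
def IsFiniteNet {Z : Type*} [MetricSpace Z] (δ : ℝ) (N A : Set Z) : Prop :=
  N.Finite ∧ N ⊆ A ∧ ∀ z ∈ A, ∃ w ∈ N, dist z w ≤ δ

/-! Let `F` be an almost isometry with error `δ` on a ball slightly larger than radius `R`, and let
`N` be a finite `δ`-net, containing `p`, of a slightly smaller ball. Let `c` send a point to a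
nearest point of `N`. Take `f = F ∘ c`, and let `g z` be a `v ∈ N` with `F v` nearest to `z`. Both
have finitely many values with Borel fibres, so they are measurable for every completion
(`exists_measurable_nearest`). Shrinking the net's ball keeps all values inside the open balls of
radius `R`. The length structure ensures that it costs only a multiple of `δ`: a point near the
boundary can be moved inwards along an almost shortest curve (`IsLengthSpace.exists_dist_eq`). A
diagonal choice of scales then gives the sequences. -/

/-- A measurable nearest-point selection: for a finite family of points `F w`, `w ∈ N`, there is a
map choosing for each `y` an index of a nearest point, preferring `p` at the point `F p`. -/
theorem exists_measurable_nearest {Y W : Type*} [MetricSpace Y] [MeasurableSpace Y]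
    [OpensMeasurableSpace Y] (F : W → Y) (p : W) {N : Set W} (hN : N.Finite) (hp : p ∈ N) :
    ∃ c : Y → W, (∀ S : Set W, MeasurableSet (c ⁻¹' S)) ∧ (∀ y, c y ∈ N) ∧ c (F p) = p ∧
      ∀ y, ∀ w ∈ N, dist y (F (c y)) ≤ dist y (F w) := by
  classical
  suffices H : ∀ M : Set W, M.Finite → ∃ c : Y → W, (∀ S : Set W, MeasurableSet (c ⁻¹' S)) ∧
      (∀ y, c y ∈ insert p M) ∧ c (F p) = p ∧
      ∀ y, ∀ w ∈ insert p M, dist y (F (c y)) ≤ dist y (F w) by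
    obtain ⟨c, h⟩ := H N hN
    rw [insert_eq_of_mem hp] at h
    exact ⟨c, h⟩
  intro M hM
  induction M, hM using Set.Finite.induction_on with
  | empty => exact ⟨fun _ => p, fun S => .const (p ∈ S),
      by simp, rfl, by simp⟩
  | @insert w M _ hM ih =>
    obtain ⟨c, hc, hcM, hcp, hmin⟩ := ih
    -- The strict inequality resolves ties in favour of the earlier choice, so `p` is never replaced
    -- at `F p`, where its distance is already zero.
    set A : Set Y := {y | dist y (F w) < dist y (F (c y))} with hA
    have hAm : MeasurableSet A := by
      -- On each of the finitely many fibres of `c`, the condition compares two continuous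
      -- functions.
      have : A = ⋃ v ∈ insert p M, (c ⁻¹' {v} ∩ {y | dist y (F w) < dist y (F v)}) := by
        ext y
        simp only [hA, mem_ofPred_eq, mem_iUnion, mem_inter_iff, mem_preimage, mem_singleton_iff,
          exists_prop]
        constructor
        · intro h
          exact ⟨c y, hcM y, rfl, h⟩
        · rintro ⟨v, -, rfl, h⟩
          exact h
      rw [this]
      refine .biUnion (hM.insert p).countable fun v _ => ?_
      exact (hc _).inter (isOpen_lt (by fun_prop) (by fun_prop)).measurableSet
    refine ⟨fun y => if y ∈ A then w else c y, ?_, ?_, ?_, ?_⟩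
    · intro S
      have : (fun y => if y ∈ A then w else c y) ⁻¹' S
          = (A ∩ {_y | w ∈ S}) ∪ (Aᶜ ∩ c ⁻¹' S) := by
        ext y
        by_cases h : y ∈ A <;> simp [h]
      rw [this]
      exact (hAm.inter (.const _)).union (hAm.compl.inter (hc S))
    · intro y
      have := hcM y
      dsimp only
      split_ifs
      · simp
      · rcases this with h | h
        · exact Or.inl h
        · exact Or.inr (Or.inr h)
    · have : F p ∉ A := by simp [hA, hcp]
      simp [this, hcp]
    · intro y v hv
      have hle : v = w ∨ v ∈ insert p M := by
        rcases hv with h | h | h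
        · exact Or.inr (Or.inl h)
        · exact Or.inl h
        · exact Or.inr (Or.inr h)
      dsimp only
      split_ifs with h
      · rcases hle with rfl | hv
        · exact le_rfl
        · exact (le_of_lt h).trans (hmin y v hv)
      · rcases hle with rfl | hv
        · exact not_lt.1 h
        · exact hmin y v hv

/-- In a length space, one finds points at a prescribed distance `s ≤ dist p x` from `p` which are
almost on a geodesic from `p` to `x`. -/
theorem IsLengthSpace.exists_dist_eq {Z : Type*} [MetricSpace Z] (hZ : IsLengthSpace Z)
    (p x : Z) {s η : ℝ} (hs : 0 ≤ s) (hsx : s ≤ dist p x) (hη : 0 < η) :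
    ∃ y, dist p y = s ∧ dist y x ≤ dist p x + η - s := by
  have hlt : (⨅ γ : Path p x, eVariationOn γ univ) < ENNReal.ofReal (dist p x + η) := by
    rw [← hZ p x, edist_dist]
    exact (ENNReal.ofReal_lt_ofReal_iff (by positivity)).2 (by linarith)
  obtain ⟨γ, hγ⟩ := iInf_lt_iff.1 hlt
  have hcont : Continuous fun t => dist p (γ t) := by fun_prop
  obtain ⟨t, ht⟩ := mem_range_of_exists_le_of_exists_ge hcont ⟨0, by simpa using hs⟩
    ⟨1, by simpa using hsx⟩
  refine ⟨γ t, ht, ?_⟩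
  have h1 : edist (γ 0) (γ t) + edist (γ t) (γ 1) ≤ eVariationOn γ univ := by
    calc _ ≤ eVariationOn γ (Iic t) + eVariationOn γ (Ici t) :=
          add_le_add (eVariationOn.edist_le _ (mem_Iic.2 t.2.1) self_mem_Iic)
            (eVariationOn.edist_le _ self_mem_Ici (mem_Ici.2 t.2.2))
      _ ≤ eVariationOn γ (Iic t ∪ Ici t) :=
          eVariationOn.add_le_union _ fun a ha b hb => le_trans ha hb
      _ ≤ _ := eVariationOn.mono _ (subset_univ _)
  have h2 := h1.trans hγ.le
  rw [γ.source, γ.target, edist_dist, edist_dist, ← ENNReal.ofReal_add dist_nonneg dist_nonneg,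
    ENNReal.ofReal_le_ofReal_iff (by positivity)] at h2
  linarith

/-! ### Measurable approximations at a fixed scale -/

/-- A pair of measurable, mutually almost inverse `ε`-approximations between the closures of the
open balls of radius `R` around `p` and `q`, of which the first has a finite image. -/
structure IsMeasurableApprox {Z W : Type*} [MetricSpace Z] [MeasurableSpace Z] [MetricSpace W]
    [MeasurableSpace W] (p : Z) (q : W) (R ε : ℝ) (f : Z → W) (g : W → Z) : Prop where
  mapsTo_f : MapsTo f (closure (Metric.ball p R)) (Metric.ball q R)
  mapsTo_g : MapsTo g (closure (Metric.ball q R)) (Metric.ball p R)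
  measurable_f : Measurable f
  measurable_g : Measurable g
  finite_image : (f '' closure (Metric.ball p R)).Finite
  dist_f : ∀ x ∈ closure (Metric.ball p R), ∀ y ∈ closure (Metric.ball p R),
    |dist (f x) (f y) - dist x y| ≤ ε
  dist_gf : ∀ x ∈ closure (Metric.ball p R), dist x (g (f x)) ≤ ε
  dist_g : ∀ x ∈ closure (Metric.ball q R), ∀ y ∈ closure (Metric.ball q R),
    |dist x y - dist (g x) (g y)| ≤ ε
  dist_fg : ∀ x ∈ closure (Metric.ball q R), dist x (f (g x)) ≤ ε
  f_base : f p = q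
  g_base : g q = p

/-- The closure of an open ball consists of points at distance at most the radius. -/
theorem dist_le_of_mem_closure_ball {Z : Type*} [MetricSpace Z] {p x : Z} {R : ℝ}
    (hx : x ∈ closure (Metric.ball p R)) : dist x p ≤ R :=
  Metric.closure_ball_subset_closedBall hx

section Approx

variable {Z W : Type*} [MetricSpace Z] [MeasurableSpace Z] [MetricSpace W] [MeasurableSpace W]
  {p : Z} {q : W} {R ε : ℝ}

/-- The constant maps are approximations with error twice the radius. -/
theorem isMeasurableApprox_const (p : Z) (q : W) (hR : 0 < R) :
    IsMeasurableApprox p q R (2 * R) (fun _ => q) (fun _ => p) where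
  mapsTo_f _ _ := Metric.mem_ball_self hR
  mapsTo_g _ _ := Metric.mem_ball_self hR
  measurable_f := measurable_const
  measurable_g := measurable_const
  finite_image := (finite_singleton q).subset (by rintro _ ⟨x, -, rfl⟩; rfl)
  dist_f x hx y hy := by
    have := dist_triangle_right x y p
    have := dist_le_of_mem_closure_ball hx
    have := dist_le_of_mem_closure_ball hy
    rw [dist_self, zero_sub, abs_neg, abs_of_nonneg dist_nonneg]
    linarith
  dist_gf x hx := by
    have := dist_le_of_mem_closure_ball hx
    linarith
  dist_g x hx y hy := by
    have := dist_triangle_right x y q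
    have := dist_le_of_mem_closure_ball hx
    have := dist_le_of_mem_closure_ball hy
    rw [dist_self, sub_zero, abs_of_nonneg dist_nonneg]
    linarith
  dist_fg x hx := by
    have := dist_le_of_mem_closure_ball hx
    linarith
  f_base := rfl
  g_base := rfl

/-- The image of the first map of an approximation is a finite net. -/
theorem IsMeasurableApprox.isFiniteNet {f : Z → W} {g : W → Z}
    (h : IsMeasurableApprox p q R ε f g) (hε : 0 ≤ ε) :
    IsFiniteNet (2 * ε) (f '' closure (Metric.ball p R)) (Metric.ball q R) := by
  refine ⟨h.finite_image, h.mapsTo_f.image_subset, fun z hz => ?_⟩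
  have hz' := subset_closure hz
  refine ⟨f (g z), mem_image_of_mem f (subset_closure (h.mapsTo_g hz')), ?_⟩
  linarith [h.dist_fg z hz']

/-- A map on a slightly larger ball of a proper length space which distorts distances by less than
`δ` and has `δ`-dense image yields measurable approximations. -/
theorem exists_isMeasurableApprox_of_almost_isometry [OpensMeasurableSpace Z]
    [OpensMeasurableSpace W] [ProperSpace Z] (hZ : IsLengthSpace Z) {δ : ℝ} (hδ : 0 < δ)
    (hδR : 3 * δ < R) (hδε : 20 * δ ≤ ε) (F : Z → W) (hFp : F p = q)
    (hF : ∀ x ∈ Metric.ball p (R + 4 * δ), ∀ y ∈ Metric.ball p (R + 4 * δ),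
      |dist (F x) (F y) - dist x y| < δ)
    (hdense : Metric.ball q (R + 4 * δ - δ) ⊆
      Metric.thickening δ (F '' Metric.ball p (R + 4 * δ))) :
    ∃ (f : Z → W) (g : W → Z), IsMeasurableApprox p q R ε f g := by
  have hpr : p ∈ Metric.ball p (R + 4 * δ) := Metric.mem_ball_self (by linarith)
  have hpR : p ∈ Metric.ball p (R - 2 * δ) := Metric.mem_ball_self (by linarith)
  have htb : TotallyBounded (Metric.ball p (R - 2 * δ)) :=
    (isCompact_closedBall p (R - 2 * δ)).totallyBounded.subset Metric.ball_subset_closedBall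
  obtain ⟨N₀, hN₀, hN₀fin, hcov⟩ := Metric.finite_approx_of_totallyBounded htb δ hδ
  set N : Set Z := insert p N₀ with hN
  have hNfin : N.Finite := hN₀fin.insert p
  have hNball : N ⊆ Metric.ball p (R - 2 * δ) := insert_subset hpR hN₀
  have hpN : p ∈ N := mem_insert _ _
  have hNr : ∀ {v}, v ∈ N → v ∈ Metric.ball p (R + 4 * δ) := fun hv =>
    Metric.ball_subset_ball (by linarith) (hNball hv)
  obtain ⟨c, hcm, hcN, hcp, hcmin⟩ := exists_measurable_nearest (id : Z → Z) p hNfin hpN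
  obtain ⟨g, hgm, hgN, hgp, hgmin⟩ := exists_measurable_nearest F p hNfin hpN
  simp only [id] at hcp hcmin
  -- Moving `x` inwards to the sphere of radius `R - 3 * δ` costs less than `6 * δ`, and the net
  -- adds `δ`.
  have hc : ∀ x, dist x p < R + 2 * δ → dist x (c x) ≤ 7 * δ := by
    have key : ∀ x, dist x p < R - 2 * δ → ∃ v ∈ N, dist x v < δ := by
      intro x hx
      obtain ⟨v, hv, hxv⟩ := mem_iUnion₂.1 (hcov (Metric.mem_ball.2 hx))
      exact ⟨v, mem_insert_of_mem _ hv, hxv⟩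
    intro x hx
    rcases lt_or_ge (dist x p) (R - 2 * δ) with h | h
    · obtain ⟨v, hv, hxv⟩ := key x h
      linarith [hcmin x v hv]
    · obtain ⟨y, hy1, hy2⟩ := hZ.exists_dist_eq p x (s := R - 3 * δ) (by linarith)
        (by rw [dist_comm]; linarith) hδ
      obtain ⟨v, hv, hyv⟩ := key y (by rw [dist_comm]; linarith)
      have := hcmin x v hv
      have := dist_triangle x y v
      rw [dist_comm y x, dist_comm p x] at hy2
      linarith
  have hFc : ∀ x ∈ Metric.ball p (R + 2 * δ), dist (F x) (F (c x)) ≤ 8 * δ := by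
    intro x hx
    have h1 := abs_lt.1 (hF x (Metric.ball_subset_ball (by linarith) hx) (c x) (hNr (hcN x)))
    linarith [hc x hx]
  -- Density gives `F x` within `δ` of `z`, which forces `dist x p < R + 2 * δ`; then `hFc` adds `8
  -- * δ`.
  have hFg : ∀ z, dist z q ≤ R → dist z (F (g z)) ≤ 9 * δ := by
    intro z hz
    obtain ⟨_, ⟨x, hx, rfl⟩, hzx⟩ := Metric.mem_thickening_iff.1
      (hdense (Metric.mem_ball.2 (by linarith : dist z q < R + 4 * δ - δ)))
    have h1 := abs_lt.1 (hF x hx p hpr)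
    rw [hFp] at h1
    have h2 := dist_triangle_left (F x) q z
    have h3 := hFc x (Metric.mem_ball.2 (by linarith))
    have h4 := dist_triangle z (F x) (F (c x))
    linarith [hgmin z (c x) (hcN x)]
  have hNF : ∀ v ∈ N, dist (F v) q < R := by
    intro v hv
    have h1 := abs_lt.1 (hF v (hNr hv) p hpr)
    rw [hFp] at h1
    have h2 := Metric.mem_ball.1 (hNball hv)
    linarith
  refine ⟨fun x => F (c x), g, ?_⟩
  constructor
  case mapsTo_f => exact fun x _ => hNF _ (hcN x)
  case mapsTo_g => exact fun z _ => Metric.ball_subset_ball (by linarith) (hNball (hgN z))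
  case measurable_f => exact fun S _ => hcm (F ⁻¹' S)
  case measurable_g => exact fun S _ => hgm S
  case finite_image =>
    refine (hNfin.image F).subset ?_
    rintro _ ⟨x, -, rfl⟩
    exact mem_image_of_mem F (hcN x)
  case dist_f =>
    intro x hx y hy
    have hx1 := hc x (by linarith [dist_le_of_mem_closure_ball hx])
    have hy1 := hc y (by linarith [dist_le_of_mem_closure_ball hy])
    have h1 := abs_lt.1 (hF _ (hNr (hcN x)) _ (hNr (hcN y)))
    have h2 := abs_le.1 (Real.dist_eq _ _ ▸ dist_dist_dist_le x y (c x) (c y))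
    exact abs_le.2 ⟨by linarith, by linarith⟩
  case dist_gf =>
    intro x hx
    -- The nearest image to `F (c x)` is at distance zero, so `g (F (c x))` and `c x` have the same
    -- image under `F` and are less than `δ` apart.
    have hx1 := hc x (by linarith [dist_le_of_mem_closure_ball hx])
    have h1 := hgmin (F (c x)) (c x) (hcN x)
    rw [dist_self] at h1
    have h2 := abs_lt.1 (hF _ (hNr (hcN x)) _ (hNr (hgN (F (c x)))))
    have h3 := dist_triangle x (c x) (g (F (c x)))
    linarith
  case dist_g =>
    -- This is the largest error: `9 * δ` at each end plus the distortion `δ`, hence the factor `20`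
    -- in the hypothesis.
    intro x hx y hy
    have hx1 := hFg x (dist_le_of_mem_closure_ball hx)
    have hy1 := hFg y (dist_le_of_mem_closure_ball hy)
    have h1 := abs_lt.1 (hF _ (hNr (hgN x)) _ (hNr (hgN y)))
    have h2 := abs_le.1 (Real.dist_eq _ _ ▸ dist_dist_dist_le x y (F (g x)) (F (g y)))
    exact abs_le.2 ⟨by linarith, by linarith⟩
  case dist_fg =>
    intro z hz
    have h1 := hFg z (dist_le_of_mem_closure_ball hz)
    have h2 := hFc (g z) (Metric.ball_subset_ball (by linarith) (hNball (hgN z)))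
    have h3 := dist_triangle z (F (g z)) (F (c (g z)))
    linarith
  case f_base => simp only [hcp, hFp]
  case g_base => rw [← hFp, hgp]

end Approx

/-! ### Diagonal choice of scales -/

/-- Pointed Gromov-Hausdorff convergence of proper length spaces yields measurable approximations
at every scale and with every precision for all large indices. -/
theorem PointedGHConverges.eventually_exists_isMeasurableApprox {X : ℕ → Type*}
    [∀ n, MetricSpace (X n)] [∀ n, MeasurableSpace (X n)] [∀ n, OpensMeasurableSpace (X n)]
    {Y : Type*} [MetricSpace Y] [MeasurableSpace Y] [OpensMeasurableSpace Y]
    (hproper : ∀ n, ProperSpace (X n)) (hlength : ∀ n, IsLengthSpace (X n))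
    {p : ∀ n, X n} {q : Y} (hGH : PointedGHConverges p q) {R ε : ℝ} (hR : 0 < R) (hε : 0 < ε) :
    ∃ i₀, ∀ i ≥ i₀, ∃ (f : X i → Y) (g : Y → X i), IsMeasurableApprox (p i) q R ε f g := by
  obtain ⟨δ, hδ, hδ'⟩ := exists_between (lt_min (div_pos hε (by norm_num : (0 : ℝ) < 20))
    (div_pos hR (by norm_num : (0 : ℝ) < 3)))
  rw [lt_min_iff, lt_div_iff₀ (by norm_num), lt_div_iff₀ (by norm_num)] at hδ'
  obtain ⟨i₀, h⟩ := hGH (R + 4 * δ) (by linarith) δ hδ (by linarith)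
  refine ⟨i₀, fun i hi => ?_⟩
  obtain ⟨F, hFp, hF, hdense⟩ := h i hi
  have := hproper i
  exact exists_isMeasurableApprox_of_almost_isometry (hlength i) hδ (by linarith) (by linarith)
    F hFp hF hdense

/-- Diagonal sequences: if `P k` holds eventually for each `k` and `P 0` holds always, there is a
monotone `k : ℕ → ℕ` tending to infinity such that `P (k n) n` holds for all `n`. -/
theorem exists_monotone_tendsto_diagonal {P : ℕ → ℕ → Prop} (h0 : ∀ n, P 0 n)
    (h : ∀ k, ∃ i₀, ∀ i ≥ i₀, P k i) :
    ∃ k : ℕ → ℕ, Monotone k ∧ Tendsto k atTop atTop ∧ ∀ n, P (k n) n := by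
  classical
  choose N hN using h
  -- The search returns `0` when no `k` qualifies; `h0` covers that case.
  refine ⟨fun n => Nat.findGreatest (fun k => N k ≤ n) n, ?_, ?_, ?_⟩
  · intro a b hab
    exact Nat.findGreatest_mono (fun k hk => le_trans hk hab) hab
  · refine tendsto_atTop.2 fun k => eventually_atTop.2 ⟨max k (N k), fun n hn => ?_⟩
    exact Nat.le_findGreatest ((le_max_left _ _).trans hn) ((le_max_right _ _).trans hn)
  · intro n
    rcases Nat.eq_zero_or_pos (Nat.findGreatest (fun k => N k ≤ n) n) with h | h
    · simpa only [h] using h0 n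
    · exact hN _ n (Nat.findGreatest_of_ne_zero (P := fun k => N k ≤ n) rfl h.ne')

theorem proposition2p2 {X : ℕ → Type*} [∀ n, MetricSpace (X n)] [∀ n, MeasurableSpace (X n)]
    [∀ n, BorelSpace (X n)] (m : ∀ n, Measure (X n))
    {Xinf : Type*} [MetricSpace Xinf] [CompleteSpace Xinf] [MeasurableSpace Xinf]
    [BorelSpace Xinf]
    (V : ℕ → ℝ → ℝ) (Vinf Vl Vu : ℝ → ℝ)
    (hvol : UniformVolumeGrowth m V Vinf Vl Vu)
    (hV : GaugesConverge V Vinf)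
    (hproper : ∀ n, ProperSpace (X n)) (hlength : ∀ n, IsLengthSpace (X n))
    (p : ∀ n, X n) (pinf : Xinf) (hGH : PointedGHConverges p pinf) :
    ∃ (ε R : ℕ → ℝ) (f : ∀ n, X n → Xinf) (g : ∀ n, Xinf → X n),
      (∀ n, 0 < ε n) ∧ Antitone ε ∧ Tendsto ε atTop (𝓝 0) ∧
      (∀ n, 0 < R n) ∧ Monotone R ∧ Tendsto R atTop atTop ∧
      (∀ n, MapsTo (f n) (closure (Metric.ball (p n) (R n))) (Metric.ball pinf (R n))) ∧
      (∀ n, MapsTo (g n) (closure (Metric.ball pinf (R n))) (Metric.ball (p n) (R n))) ∧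
      (∀ n, CompletionMeasurableOn (m n) (f n) (closure (Metric.ball (p n) (R n)))) ∧
      (∀ (n : ℕ) (μ : Measure Xinf),
        CompletionMeasurableOn μ (g n) (closure (Metric.ball pinf (R n)))) ∧
      (∀ n, IsFiniteNet (2 * ε n) (f n '' closure (Metric.ball (p n) (R n)))
        (Metric.ball pinf (R n))) ∧
      (∀ n, ∀ x ∈ closure (Metric.ball (p n) (R n)), ∀ y ∈ closure (Metric.ball (p n) (R n)),
        |dist (f n x) (f n y) - dist x y| ≤ ε n) ∧
      (∀ n, ∀ x ∈ closure (Metric.ball (p n) (R n)), dist x (g n (f n x)) ≤ ε n) ∧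
      (∀ n, ∀ x ∈ closure (Metric.ball pinf (R n)), ∀ y ∈ closure (Metric.ball pinf (R n)),
        |dist x y - dist (g n x) (g n y)| ≤ ε n) ∧
      (∀ n, ∀ x ∈ closure (Metric.ball pinf (R n)), dist x (f n (g n x)) ≤ ε n) ∧
      (∀ n, f n (p n) = pinf) ∧
      (∀ n, g n pinf = p n) := by
  -- The numerator `2` makes the scale `k = 0` (radius `1`, error `2`) attainable by constant maps
  -- for every `n`, which settles the early indices.
  obtain ⟨k, hkmono, hktop, hk⟩ := exists_monotone_tendsto_diagonal
    (P := fun k n => ∃ (f : X n → Xinf) (g : Xinf → X n),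
      IsMeasurableApprox (p n) pinf ((k : ℝ) + 1) (2 / ((k : ℝ) + 1)) f g)
    (fun n => ⟨_, _, by simpa using isMeasurableApprox_const (p n) pinf one_pos⟩)
    (fun k => hGH.eventually_exists_isMeasurableApprox hproper hlength (by positivity)
      (by positivity))
  choose f g h using hk
  have hkmono' : Monotone fun n => (k n : ℝ) + 1 := fun a b hab => by
    have : (k a : ℝ) ≤ k b := Nat.cast_le.2 (hkmono hab)
    simpa using this
  have hktop' : Tendsto (fun n => (k n : ℝ) + 1) atTop atTop :=
    tendsto_atTop_add_const_right _ _ (tendsto_natCast_atTop_atTop.comp hktop)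
  have hpos : ∀ n, 0 < 2 / ((k n : ℝ) + 1) := fun n => by positivity
  exact ⟨fun n => 2 / ((k n : ℝ) + 1), fun n => (k n : ℝ) + 1, f, g, hpos,
    fun a b hab => div_le_div_of_nonneg_left (by norm_num) (by positivity) (hkmono' hab),
    hktop'.const_div_atTop 2, fun n => by positivity, hkmono', hktop',
    fun n => (h n).mapsTo_f, fun n => (h n).mapsTo_g,
    fun n S hS => (isClosed_closure.measurableSet.inter
      ((h n).measurable_f hS)).nullMeasurableSet,
    fun n μ S hS => (isClosed_closure.measurableSet.inter
      ((h n).measurable_g hS)).nullMeasurableSet,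
    fun n => (h n).isFiniteNet (hpos n).le,
    fun n => (h n).dist_f, fun n => (h n).dist_gf, fun n => (h n).dist_g,
    fun n => (h n).dist_fg, fun n => (h n).f_base, fun n => (h n).g_base⟩
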